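/- **Notation.** For sets of ordinals $C,D$: $\mathrm{acc}(C)=\{\alpha\in C\mid \sup(C\cap\alpha)=\alpha>0\}$, $\mathrm{nacc}(C)=C\setminus\mathrm{acc}(C)$; for $j<\mathrm{otp}(C)$, $C(j)$ is the unique $\delta\in C$ with $\mathrm{otp}(C\cap\delta)=j$; for an ordinal $\sigma$, $\mathrm{suc}_\sigma(C)=\{C(j+1)\mid j<\sigma,\ j+1<\mathrm{otp}(C)\}$. Write $D\sqsubseteq C$ iff $D=C\cap\beta$ for some ordinal $\beta$; $D\mathrel{{}_{\chi}{\sqsubseteq}}C$ iff $D\sqsubseteq C$ or $\mathrm{cf}(\sup D)<\chi$; and $D\sqsubseteq_\chi C$ iff $D\sqsubseteq C$, or $\mathrm{otp}(C)<\chi$ and $\mathrm{nacc}(C)$ consists only of successor ordinals. Let $E^\kappa_{\ge\chi}=\{\alpha<\kappa\mid \mathrm{cf}(\alpha)\ge\chi\}$. A *$C$-sequence over $\kappa$* is a sequence $\vec C=\langle C_\alpha\mid\alpha<\kappa\rangle$ such that $C_\alpha$ is a club subset of $\alpha$ for every limit $\alpha<\kappa$. It is *$\mathcal R$-coherent* if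 for all $\alpha<\kappa$ and $\bar\alpha\in\mathrm{acc}(C_\alpha)$, we have $\bar\alpha<\kappa$ and $C_{\bar\alpha}\mathrel{\mathcal R}C_\alpha$. With respect to $\vec C$, an ordinal $\delta<\kappa$ *captures* $\vec A=\langle A_i\mid i<\theta\rangle$ if $\min(C_\delta)\ge\min(A_0)$ and, for all $i<\min\{\delta,\theta\}$, there is $\iota\in\mathrm{otp}(C_\delta)$ with $C_\delta(\iota),C_\delta(\iota+1)\in A_i$. The *proxy principle* $\mathrm P^-(\kappa,2,\mathcal R,\theta,\mathcal S,2,\sigma)$ asserts that there is a sequence $\langle C_\alpha\mid\alpha<\kappa\rangle$ such that: for every limit $\alpha<\kappa$, $C_\alpha$ is a club subset of $\alpha$ and $C_{\bar\alpha}\mathrel{\mathcal R}C_\alpha$ for all $\bar\alpha\in\mathrm{acc}(C_\alpha)$; and for every sequence $\langle A_i\mid i<\theta\rangle$ of cofinal subsets of $\kappa$ and every $S\in\mathcal S$, there are stationarily many $\alpha\in S$ such that $\sup\{\beta\in C_\alpha\mid \mathrm{suc}_\sigma(C_\alpha\setminus\beta)\subseteq A_i\}=\alpha$ for all $i<\min\{\alpha,\theta\}$.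 The principle $\mathrm P(\kappa,2,\mathcal R,\theta,\mathcal S,2,\sigma)$ asserts that both $\mathrm P^-(\kappa,2,\mathcal R,\theta,\mathcal S,2,\sigma)$ and $\diamondsuit(\kappa)$ hold. **Theorem.** Suppose that $\chi<\kappa$ are infinite regular cardinals, and $\theta<\kappa$ is a nonzero cardinal. 1. If $\mathrm P^-(\kappa,2,{}_{\chi}{\sqsubseteq},\kappa,\{E^\kappa_{\ge\chi}\},2,2)$ holds, then there exists a ${}_{\chi}{\sqsubseteq}$-coherent $C$-sequence over $\kappa$ such that $S(\vec A)=\{\delta<\kappa\mid\delta\text{ captures }\vec A\}$ is stationary for every sequence $\vec A=\langle A_i\mid i<\kappa\rangle$ of cofinal subsets of $\kappa$. 2. If $\mathrm P^-(\kappa,2,\sqsubseteq_\chi,\kappa,\{\kappa\},2,2)$ holds, then there exists a $\sqsubseteq_\chi$-coherent $C$-sequence over $\kappa$ such that $S(\vec A)$ is stationary for every sequence $\vec A=\langle A_i\mid i<\kappa\rangle$ of cofinal subsets of $\kappa$. 3. If $\mathrm P(\kappa,2,{}_{\chi}{\sqsubseteq},\theta,\{E^\kappa_{\ge\chi}\},2,1)$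 holds, then there exists a ${}_{\chi}{\sqsubseteq}$-coherent $C$-sequence over $\kappa$ such that $S(\vec A)$ is stationary for every sequence $\vec A=\langle A_i\mid i<\theta\rangle$ of cofinal subsets of $\kappa$. 4. If $\mathrm P(\kappa,2,\sqsubseteq_\chi,\theta,\{\kappa\},2,1)$ holds, then there exists a $\sqsubseteq_\chi$-coherent $C$-sequence over $\kappa$ such that $S(\vec A)$ is stationary for every sequence $\vec A=\langle A_i\mid i<\theta\rangle$ of cofinal subsets of $\kappa$. -/

import Mathlib

universe u

namespace ProxyCapture

open Set Order

/-! ### Sets of ordinals -/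

/-- `C` is a club subset of the (limit) ordinal `α`. -/
def IsClubIn (α : Ordinal.{u}) (C : Set Ordinal.{u}) : Prop :=
  C ⊆ Iio α ∧ IsClub (Subtype.val ⁻¹' C : Set (Iio α))

/-- `S` is a stationary subset of the ordinal `κ`. -/
def IsStationaryIn (κ : Ordinal.{u}) (S : Set Ordinal.{u}) : Prop :=
  S ⊆ Iio κ ∧ IsStationary (Subtype.val ⁻¹' S : Set (Iio κ))

/-- `A` is a cofinal subset of the ordinal `κ`. -/
def IsCofinalIn (κ : Ordinal.{u}) (A : Set Ordinal.{u}) : Prop :=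
  A ⊆ Iio κ ∧ IsCofinal (Subtype.val ⁻¹' A : Set (Iio κ))

/-- `acc(C)`: the `α ∈ C` with `sup (C ∩ α) = α > 0`. -/
def acc (C : Set Ordinal.{u}) : Set Ordinal.{u} :=
  {α ∈ C | sSup (C ∩ Iio α) = α ∧ 0 < α}

/-- `nacc(C) = C \ acc(C)`. -/
def nacc (C : Set Ordinal.{u}) : Set Ordinal.{u} :=
  C \ acc C

/-- The order type of a set of ordinals. A set of ordinals of universe level `u` lives one universe
higher, so its order type is compared with ordinals of level `u` through `Ordinal.lift`. -/
noncomputable def otp (C : Set Ordinal.{u}) : Ordinal.{u + 1} :=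
  Ordinal.type ((· < ·) : C → C → Prop)

/-- `IsNth C j δ` says that `j < otp(C)` and `C(j) = δ`, that is, `δ` is the (unique) element of `C`
with `otp(C ∩ δ) = j`. -/
def IsNth (C : Set Ordinal.{u}) (j δ : Ordinal.{u}) : Prop :=
  δ ∈ C ∧ otp (C ∩ Iio δ) = Ordinal.lift.{u + 1} j

/-- `suc_σ(C) = {C(j + 1) | j < σ, j + 1 < otp(C)}`. -/
def suc (σ : Ordinal.{u}) (C : Set Ordinal.{u}) : Set Ordinal.{u} :=
  {δ | ∃ j < σ, IsNth C (j + 1) δ}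

/-- `D ⊑ C`: `D` is an initial segment of `C` of the form `C ∩ β`. -/
def InitSeg (D C : Set Ordinal.{u}) : Prop :=
  ∃ β : Ordinal.{u}, D = C ∩ Iio β

/-- The relation written as `⊑` with a left subscript `χ`:
either `D ⊑ C` or `cf(sup D) < χ`. -/
def InitSegUpper (χ : Cardinal.{u}) (D C : Set Ordinal.{u}) : Prop :=
  InitSeg D C ∨ (sSup D).cof < χ

/-- `D ⊑_χ C`: either `D ⊑ C`, or `otp(C) < χ` and `nacc(C)` consists only of
successor ordinals. -/
def InitSegLower (χ : Cardinal.{u}) (D C : Set Ordinal.{u}) : Prop :=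
  InitSeg D C ∨
    (otp C < Ordinal.lift.{u + 1} χ.ord ∧ ∀ β ∈ nacc C, ∃ γ, β = succ γ)

/-- `E^κ_{≥χ}`: the ordinals below `κ` of cofinality at least `χ`. -/
def cofGE (κ χ : Cardinal.{u}) : Set Ordinal.{u} :=
  {α | α < κ.ord ∧ χ ≤ α.cof}

/-! ### `C`-sequences

A sequence indexed by a set of ordinals is represented by a function on all ordinals, of which only
the values at the indices matter. -/

/-- `C` is a `C`-sequence over the set of ordinals `Γ`. -/
def IsCSequence (Γ : Set Ordinal.{u}) (C : Ordinal.{u} → Set Ordinal.{u}) : Prop :=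
  ∀ α ∈ Γ, IsSuccLimit α → IsClubIn α (C α)

/-- The `C`-sequence `C` over `Γ` is `R`-coherent. -/
def IsCoherent (R : Set Ordinal.{u} → Set Ordinal.{u} → Prop) (Γ : Set Ordinal.{u})
    (C : Ordinal.{u} → Set Ordinal.{u}) : Prop :=
  ∀ α ∈ Γ, ∀ β ∈ acc (C α), β ∈ Γ ∧ R (C β) (C α)

/-- With respect to the `C`-sequence `C`, the ordinal `δ` captures the sequence
`⟨A i | i < θ⟩`. -/
def Captures (C : Ordinal.{u} → Set Ordinal.{u}) (θ : Ordinal.{u})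
    (A : Ordinal.{u} → Set Ordinal.{u}) (δ : Ordinal.{u}) : Prop :=
  ((C δ).Nonempty ∧ sInf (A 0) ≤ sInf (C δ)) ∧
    ∀ i < min δ θ, ∃ ι x y, IsNth (C δ) ι x ∧ IsNth (C δ) (ι + 1) y ∧ x ∈ A i ∧ y ∈ A i

/-- For every sequence `⟨A i | i < θ⟩` of cofinal subsets of `κ`, the set of all `δ < κ` that
capture it is stationary in `κ`. -/
def CapturesStationarily (κ θ : Cardinal.{u}) (C : Ordinal.{u} → Set Ordinal.{u}) : Prop :=
  ∀ A : Ordinal.{u} → Set Ordinal.{u}, (∀ i < θ.ord, IsCofinalIn κ.ord (A i)) →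
    IsStationaryIn κ.ord {δ | δ < κ.ord ∧ Captures C θ.ord A δ}

/-! ### Diamond and the proxy principle -/

/-- `◇(κ)`. -/
def Diamond (κ : Cardinal.{u}) : Prop :=
  ∃ Z : Ordinal.{u} → Set Ordinal.{u}, (∀ β < κ.ord, Z β ⊆ Iio β) ∧
    ∀ X ⊆ Iio κ.ord, IsStationaryIn κ.ord {β | β < κ.ord ∧ X ∩ Iio β = Z β}

/-- The proxy principle `P⁻(κ, 2, R, θ, 𝒮, 2, σ)`. -/
def ProxyMinus (κ : Cardinal.{u}) (R : Set Ordinal.{u} → Set Ordinal.{u} → Prop)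
    (θ : Cardinal.{u}) (𝒮 : Set (Set Ordinal.{u})) (σ : Ordinal.{u}) : Prop :=
  ∃ C : Ordinal.{u} → Set Ordinal.{u},
    (∀ α < κ.ord, IsSuccLimit α → IsClubIn α (C α)) ∧
    (∀ α < κ.ord, IsSuccLimit α → ∀ β ∈ acc (C α), R (C β) (C α)) ∧
    ∀ A : Ordinal.{u} → Set Ordinal.{u}, (∀ i < θ.ord, IsCofinalIn κ.ord (A i)) →
      ∀ S ∈ 𝒮, IsStationaryIn κ.ord
        {α ∈ S | ∀ i < min α θ.ord, sSup {β ∈ C α | suc σ (C α \ Iio β) ⊆ A i} = α}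

/-- The proxy principle `P(κ, 2, R, θ, 𝒮, 2, σ)`. -/
def Proxy (κ : Cardinal.{u}) (R : Set Ordinal.{u} → Set Ordinal.{u} → Prop)
    (θ : Cardinal.{u}) (𝒮 : Set (Set Ordinal.{u})) (σ : Ordinal.{u}) : Prop :=
  ProxyMinus κ R θ 𝒮 σ ∧ Diamond κ

end ProxyCapture

open ProxyCapture

/-! Let `C` witness the proxy principle. It already hits the given cofinal sets, but nothing
controls `min (C δ)`. So `κ` many variants are considered, the `γ`-th one discarding the elements `≤
γ` of `C δ` when `γ < δ`. If every variant failed, each `γ` would have a bad sequence `A γ` and a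
club `D γ` avoiding the ordinals that capture it. A single `δ` in the diagonal intersection of the
`D γ` is found where `C δ` meets all relevant sets at once. Then some `α ∈ C δ` is chosen whose
successor `ε` in `C δ` lies in a set that controls `min (A α 0)`. Cutting at `α` makes `δ` capture
`A α`, a contradiction.

For `σ = 2` the sets `A γ i` are coded as one `κ`-sequence, and `C δ` itself supplies the
consecutive pairs. For `σ = 1` only single points are hit. They are made to hit ordinals `β` at
which diamond guesses all `A γ i ∩ β` with `γ < β`, and the gap of `C δ` below such a `β` receives
two points of the guess (`fill`). A gap gains at most two points, so no limit point is created, and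
the filling depends only on the gap, so coherence survives. -/

namespace ProxyCapture

open Set Order Cardinal

/-! ### Limit points, clubs and stationary sets of ordinals -/

/-- `p` is a nonzero limit of elements of `C` below it. -/
def LimPt (C : Set Ordinal.{u}) (p : Ordinal.{u}) : Prop :=
  0 < p ∧ ∀ q < p, ∃ c ∈ C, q < c ∧ c < p

theorem LimPt.mono {C D : Set Ordinal.{u}} {p : Ordinal.{u}} (h : LimPt C p) (hCD : C ⊆ D) :
    LimPt D p :=
  ⟨h.1, fun q hq => let ⟨c, hc, h'⟩ := h.2 q hq; ⟨c, hCD hc, h'⟩⟩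

theorem LimPt.isSuccLimit {C : Set Ordinal.{u}} {p : Ordinal.{u}} (h : LimPt C p) :
    IsSuccLimit p := by
  rw [Ordinal.isSuccLimit_iff]
  refine ⟨h.1.ne', fun a ha => ?_⟩
  obtain ⟨c, -, h1, h2⟩ := h.2 a ha.1
  exact ha.2 h1 h2

theorem mem_acc_iff {C : Set Ordinal.{u}} {p : Ordinal.{u}} :
    p ∈ acc C ↔ p ∈ C ∧ LimPt C p := by
  refine ⟨fun ⟨h1, h2, h3⟩ => ⟨h1, h3, fun q hq => ?_⟩, fun ⟨h1, h2, h3⟩ => ⟨h1, ?_, h2⟩⟩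
  · have hne : (C ∩ Iio p).Nonempty := by
      by_contra hne
      rw [not_nonempty_iff_eq_empty] at hne
      rw [hne, csSup_empty] at h2
      exact h3.ne h2
    obtain ⟨c, hc, hqc⟩ := exists_lt_of_lt_csSup hne (h2.symm ▸ hq)
    exact ⟨c, hc.1, hqc, hc.2⟩
  · refine le_antisymm (csSup_le' fun c hc => hc.2.le) ?_
    by_contra hlt
    rw [not_le] at hlt
    obtain ⟨c, hc, hqc, hcp⟩ := h3 _ hlt
    exact hqc.not_ge (le_csSup ⟨p, fun c hc => hc.2.le⟩ ⟨hc, hcp⟩)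

/-- Translates clubs of the subtype `Iio δ` into conditions on ordinals: a least upper bound of a
nonempty subset either belongs to it or is a limit point of it. -/
theorem isClubIn_iff {δ : Ordinal.{u}} {C : Set Ordinal.{u}} (hδ : IsSuccLimit δ) :
    IsClubIn δ C ↔ C ⊆ Iio δ ∧ (∀ q < δ, ∃ c ∈ C, q < c) ∧ ∀ p < δ, LimPt C p → p ∈ C := by
  refine and_congr_right fun hsub => ⟨fun h => ⟨fun q hq => ?_, fun p hp hlim => ?_⟩,
    fun h => ⟨?_, ?_⟩⟩
  · obtain ⟨c, hc, hle⟩ := h.isCofinal ⟨succ q, hδ.succ_lt hq⟩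
    exact ⟨c, hc, succ_le_iff.1 (show succ q ≤ (c : Ordinal) from hle)⟩
  · refine h.isLUB_mem (t := {x : Iio δ | (x : Ordinal) ∈ C ∧ (x : Ordinal) < p}) (x := ⟨p, hp⟩)
      (fun x hx => hx.1) ?_ ⟨fun x hx => hx.2.le, fun b hb => ?_⟩
    · obtain ⟨c, hc, -, hcp⟩ := hlim.2 0 hlim.1
      exact ⟨⟨c, hsub hc⟩, hc, hcp⟩
    · by_contra hlt
      rw [not_le] at hlt
      obtain ⟨c, hc, hbc, hcp⟩ := hlim.2 b hlt
      exact hbc.not_ge (hb (a := ⟨c, hsub hc⟩) ⟨hc, hcp⟩)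
  · intro d hd hne _ a ha
    by_cases had : a ∈ d
    · exact hd had
    have key : ∀ c ∈ d, c < a := fun c hc =>
      lt_of_le_of_ne (ha.1 hc) fun h => had (h ▸ hc)
    refine h.2 a a.2 ⟨?_, fun q hq => ?_⟩
    · obtain ⟨c, hc⟩ := hne
      exact zero_le.trans_lt (show (c : Ordinal) < a from key c hc)
    · have : ¬ (⟨q, hq.trans a.2⟩ : Iio δ) ∈ upperBounds d := fun hub => (ha.2 hub).not_gt hq
      simp only [upperBounds, mem_ofPred_eq, not_forall, not_le] at this
      obtain ⟨c, hc, hqc⟩ := this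
      exact ⟨c, hd hc, hqc, key c hc⟩
  · rintro ⟨q, hq⟩
    obtain ⟨c, hc, hqc⟩ := h.1 q hq
    exact ⟨⟨c, hsub hc⟩, hc, hqc.le⟩

theorem IsCofinalIn.exists_lt {κ : Cardinal.{u}} (hκ : ℵ₀ ≤ κ) {A : Set Ordinal.{u}}
    (hA : IsCofinalIn κ.ord A) {q : Ordinal.{u}} (hq : q < κ.ord) : ∃ c ∈ A, q < c := by
  obtain ⟨c, hc, hle⟩ := hA.2 ⟨succ q, (isSuccLimit_ord hκ).succ_lt hq⟩
  exact ⟨c, hc, succ_le_iff.1 (show succ q ≤ (c : Ordinal) from hle)⟩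

theorem isCofinalIn_of_forall_exists_lt {δ : Ordinal.{u}} {A : Set Ordinal.{u}}
    (hA : A ⊆ Iio δ) (h : ∀ q < δ, ∃ c ∈ A, q < c) : IsCofinalIn δ A :=
  ⟨hA, fun q => let ⟨c, hc, hqc⟩ := h q q.2; ⟨⟨c, hA hc⟩, hc, hqc.le⟩⟩

theorem IsClubIn.isCofinalIn {δ : Ordinal.{u}} {C : Set Ordinal.{u}} (h : IsClubIn δ C) :
    IsCofinalIn δ C :=
  ⟨h.1, h.2.isCofinal⟩

theorem IsStationaryIn.exists_mem {δ : Ordinal.{u}} {S D : Set Ordinal.{u}}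
    (hS : IsStationaryIn δ S) (hD : IsClubIn δ D) : ∃ x ∈ S, x ∈ D :=
  let ⟨x, hxS, hxD⟩ := hS.2 hD.2
  ⟨x, hxS, hxD⟩

theorem exists_isClubIn_of_not_isStationaryIn {δ : Ordinal.{u}} {S : Set Ordinal.{u}}
    (hS : S ⊆ Iio δ) (h : ¬ IsStationaryIn δ S) : ∃ D, IsClubIn δ D ∧ ∀ x ∈ D, x ∉ S := by
  have h' : ¬ IsStationary (Subtype.val ⁻¹' S : Set (Iio δ)) := fun h' => h ⟨hS, h'⟩
  obtain ⟨t, ht, hd⟩ := not_isStationary_iff.1 h'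
  refine ⟨Subtype.val '' t, ⟨?_, ?_⟩, ?_⟩
  · rintro _ ⟨x, -, rfl⟩
    exact x.2
  · rwa [preimage_image_eq _ Subtype.val_injective]
  · rintro _ ⟨x, hx, rfl⟩ hxS
    exact Set.disjoint_left.1 hd hxS hx

/-! ### Diagonal intersections and pairing below a regular cardinal -/

section Regular

variable {κ : Cardinal.{u}}

theorem IsClubIn.inter (hκ : κ.IsRegular) (hκ₀ : ℵ₀ < κ) {C D : Set Ordinal.{u}}
    (hC : IsClubIn κ.ord C) (hD : IsClubIn κ.ord D) : IsClubIn κ.ord (C ∩ D) := by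
  refine ⟨inter_subset_left.trans hC.1, IsClub.inter ?_ hC.2 hD.2⟩
  rw [Ordinal.cof_Iio, ← Ordinal.lift_cof, hκ.cof_ord]
  exact (aleph0_lt_lift.2 hκ₀).ne'

theorem isClubIn_Ioo (hκ : κ.IsRegular) {q : Ordinal.{u}} (hq : q < κ.ord) :
    IsClubIn κ.ord (Ioo q κ.ord) := by
  have hlim := isSuccLimit_ord hκ.aleph0_le
  refine (isClubIn_iff hlim).2 ⟨fun x hx => hx.2, fun r hr => ?_, fun p hp h => ?_⟩
  · have := hlim.succ_lt (max_lt hq hr)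
    exact ⟨_, ⟨(le_max_left q r).trans_lt (lt_succ _), this⟩,
      (le_max_right q r).trans_lt (lt_succ _)⟩
  · obtain ⟨c, hc, -, hcp⟩ := h.2 0 h.1
    exact ⟨hc.1.trans hcp, hp⟩

/-- The diagonal intersection of the sets `D γ`, restricted to limit ordinals below `κ`. -/
def diagonal (κ : Cardinal.{u}) (D : Ordinal.{u} → Set Ordinal.{u}) : Set Ordinal.{u} :=
  {δ | δ < κ.ord ∧ IsSuccLimit δ ∧ ∀ γ < δ, δ ∈ D γ}

/-- The limit ordinals below `κ` that are closed under `p`. -/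
def closurePoints (κ : Cardinal.{u}) (p : Ordinal.{u} → Ordinal.{u} → Ordinal.{u}) :
    Set Ordinal.{u} :=
  {δ | δ < κ.ord ∧ IsSuccLimit δ ∧ ∀ γ < δ, ∀ i < δ, p γ i < δ}

theorem isClubIn_diagonal (hκ : κ.IsRegular) (hκ₀ : ℵ₀ < κ) {D : Ordinal.{u} → Set Ordinal.{u}}
    (hD : ∀ γ < κ.ord, IsClubIn κ.ord (D γ)) :
    IsClubIn κ.ord (diagonal κ D) := by
  have hlim := isSuccLimit_ord hκ.aleph0_le
  have hD' := fun γ hγ => (isClubIn_iff hlim).1 (hD γ hγ)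
  refine (isClubIn_iff hlim).2 ⟨fun x hx => hx.1, fun q hq => ?_, fun p hp h => ?_⟩
  · choose! f hf hlt using fun γ hγ => (hD' γ hγ).2.1
    -- `g x` lies above `x` and bounds the chosen points `f γ x ∈ D γ` for all `γ < x`. Regularity
    -- keeps it below `κ`, and the supremum of its iterates from `q` is a limit point of every
    -- relevant `D γ`.
    let g : Ordinal.{u} → Ordinal.{u} := fun x => max (succ x) (⨆ γ : Iio x, f γ x)
    have hfg : ∀ x, ∀ γ < x, f γ x ≤ g x := fun x γ hγ =>
      (Ordinal.le_iSup (fun γ : Iio x => f γ x) ⟨γ, hγ⟩).trans (le_max_right _ _)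
    have hg : ∀ x < κ.ord, g x < κ.ord := fun x hx => by
      refine max_lt (hlim.succ_lt hx) (Ordinal.lift_iSup_lt_of_lt_cof.{u, u + 1} ?_ fun γ => ?_)
      · rw [← Ordinal.lift_cof, hκ.cof_ord, mk_Iio_ordinal, Cardinal.lift_lift]
        exact Cardinal.lift_lt.2 (lt_ord.1 hx)
      · exact (hD' γ (γ.2.trans hx)).1 (hf γ (γ.2.trans hx) x hx)
    have hgn : ∀ n, g^[n] q < κ.ord := fun n => by
      induction n with
      | zero => exact hq
      | succ n ih => rw [Function.iterate_succ_apply']; exact hg _ ih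
    have hstep : ∀ n, g^[n] q < g^[n + 1] q := fun n => by
      rw [Function.iterate_succ_apply']
      exact (lt_succ _).trans_le (le_max_left _ _)
    set p := ⨆ n, g^[n] q with hp
    have hlep : ∀ n, g^[n] q ≤ p := Ordinal.le_iSup fun n => g^[n] q
    have hltp : ∀ n, g^[n] q < p := fun n => (hstep n).trans_le (hlep _)
    have hpκ : p < κ.ord := by
      refine Ordinal.lift_iSup_lt_of_lt_cof.{u, 0} ?_ hgn
      simpa [hκ.cof_ord] using hκ₀
    have hlimD : ∀ γ < p, LimPt (D γ) p := fun γ hγ => by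
      refine ⟨zero_le.trans_lt hγ, fun r hr => ?_⟩
      obtain ⟨n, hn⟩ := (Ordinal.lt_iSup_iff).1 (max_lt hγ hr)
      refine ⟨f γ (g^[n] q), hf γ (hγ.trans hpκ) _ (hgn n), ?_, ?_⟩
      · exact ((le_max_right _ _).trans_lt hn).trans (hlt γ (hγ.trans hpκ) _ (hgn n))
      · refine (hfg _ γ ((le_max_left _ _).trans_lt hn)).trans_lt ?_
        rw [← Function.iterate_succ_apply' g]
        exact hltp _
    have hqp : q < p := hltp 0
    exact ⟨p, ⟨hpκ, (hlimD q hqp).isSuccLimit,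
      fun γ hγ => (hD' γ (hγ.trans hpκ)).2.2 p hpκ (hlimD γ hγ)⟩, hqp⟩
  · refine ⟨hp, h.isSuccLimit, fun γ hγ => (hD' γ (hγ.trans hp)).2.2 p hp ⟨h.1, fun q hq => ?_⟩⟩
    obtain ⟨c, hc, h1, h2⟩ := h.2 (max γ q) (max_lt hγ hq)
    exact ⟨c, hc.2.2 γ ((le_max_left _ _).trans_lt h1), (le_max_right _ _).trans_lt h1, h2⟩

theorem isClubIn_closurePoints (hκ : κ.IsRegular) (hκ₀ : ℵ₀ < κ)
    {p : Ordinal.{u} → Ordinal.{u} → Ordinal.{u}}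
    (hp : ∀ γ < κ.ord, ∀ i < κ.ord, p γ i < κ.ord) : IsClubIn κ.ord (closurePoints κ p) := by
  -- Closure under a binary function is a diagonal intersection taken twice.
  convert isClubIn_diagonal hκ hκ₀ fun γ hγ => isClubIn_diagonal hκ hκ₀ fun i hi =>
    isClubIn_Ioo hκ (hp γ hγ i hi) using 1
  ext δ
  exact ⟨fun ⟨h1, h2, h3⟩ => ⟨h1, h2, fun γ hγ => ⟨h1, h2, fun i hi => ⟨h3 γ hγ i hi, h1⟩⟩⟩,
    fun ⟨h1, h2, h3⟩ => ⟨h1, h2, fun γ hγ i hi => ((h3 γ hγ).2.2 i hi).1⟩⟩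

theorem isClubIn_limPt (hκ : κ.IsRegular) (hκ₀ : ℵ₀ < κ) {A : Set Ordinal.{u}}
    (hA : IsCofinalIn κ.ord A) : IsClubIn κ.ord {δ | δ < κ.ord ∧ LimPt A δ} := by
  have hlim := isSuccLimit_ord hκ.aleph0_le
  choose! f hf hlt using fun q => hA.exists_lt hκ.aleph0_le (q := q)
  have h := (isClubIn_iff hlim).1 (isClubIn_diagonal hκ hκ₀ fun γ hγ =>
    isClubIn_Ioo hκ (hA.1 (hf γ hγ)))
  refine (isClubIn_iff hlim).2 ⟨fun x hx => hx.1, fun q hq => ?_, fun p hp h => ⟨hp, h.1, ?_⟩⟩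
  · obtain ⟨c, ⟨hc, -, hc'⟩, hqc⟩ := h.2.1 q hq
    exact ⟨c, ⟨hc, zero_le.trans_lt hqc, fun r hr =>
      ⟨f r, hf r (hr.trans hc), hlt r (hr.trans hc), (hc' r hr).1⟩⟩, hqc⟩
  · intro q hq
    obtain ⟨c, ⟨-, hc⟩, h1, h2⟩ := h.2 q hq
    obtain ⟨a, ha, h3, h4⟩ := hc.2 q h1
    exact ⟨a, ha, h3, h4.trans h2⟩

theorem IsStationaryIn.isCofinalIn_inter (hκ : κ.IsRegular) (hκ₀ : ℵ₀ < κ)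
    {S D : Set Ordinal.{u}} (hS : IsStationaryIn κ.ord S) (hD : IsClubIn κ.ord D) :
    IsCofinalIn κ.ord (S ∩ D) :=
  isCofinalIn_of_forall_exists_lt (inter_subset_left.trans hS.1) fun _ hq =>
    let ⟨c, h1, h2, h3⟩ := hS.exists_mem (hD.inter hκ hκ₀ (isClubIn_Ioo hκ hq))
    ⟨c, ⟨h1, h2⟩, h3.1⟩

/-- Since `κ * κ = κ`, families indexed by pairs can be coded by a single index. The value `0`
outside `κ` is junk. -/
theorem exists_injective_pairing (hκ : ℵ₀ ≤ κ) :
    ∃ p : Ordinal.{u} → Ordinal.{u} → Ordinal.{u},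
      (∀ γ < κ.ord, ∀ i < κ.ord, p γ i < κ.ord) ∧
      ∀ γ < κ.ord, ∀ i < κ.ord, ∀ γ' < κ.ord, ∀ i' < κ.ord, p γ i = p γ' i' → γ = γ' ∧ i = i' := by
  have h : #(Iio κ.ord × Iio κ.ord) = #(Iio κ.ord) := by
    rw [mul_def _ _ |>.symm, mk_Iio_ordinal, card_ord]
    exact mul_eq_self (aleph0_le_lift.2 hκ)
  obtain ⟨e⟩ := Cardinal.eq.1 h
  refine ⟨fun γ i => if h : γ < κ.ord ∧ i < κ.ord then e (⟨γ, h.1⟩, ⟨i, h.2⟩) else 0,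
    fun γ hγ i hi => ?_, fun γ hγ i hi γ' hγ' i' hi' heq => ?_⟩
  · simp only [hγ, hi, and_self, dite_true]
    exact (e _).2
  · simp only [hγ, hi, hγ', hi', and_self, dite_true] at heq
    simpa [Subtype.ext_iff] using e.injective (Subtype.ext heq)

end Regular

/-! ### Order types and consecutive elements -/

section OrderType

/-- This bound brings the position of an element back to universe `u`, as `exists_isNth` needs. -/
theorem otp_inter_Iio_le (Y : Set Ordinal.{u}) (u' : Ordinal.{u}) :
    otp (Y ∩ Iio u') ≤ Ordinal.lift.{u + 1} u' := by
  rw [← Ordinal.type_lt_Iio, otp]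
  exact Ordinal.type_le_iff'.2 ⟨⟨⟨fun x => ⟨x.1, x.2.2⟩, fun x y h => by
    simpa [Subtype.ext_iff] using h⟩, Iff.rfl⟩⟩

theorem otp_mono {C D : Set Ordinal.{u}} (h : C ⊆ D) : otp C ≤ otp D :=
  Ordinal.type_le_iff'.2 ⟨⟨⟨fun x => ⟨x.1, h x.2⟩, fun x y h => by
    simpa [Subtype.ext_iff] using h⟩, Iff.rfl⟩⟩

/-- `a < b` are consecutive elements of `x`. -/
def Consecutive (x : Set Ordinal.{u}) (a b : Ordinal.{u}) : Prop :=
  a ∈ x ∧ b ∈ x ∧ a < b ∧ ∀ c ∈ x, c ≤ a ∨ b ≤ c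

theorem Consecutive.otp_eq {Y : Set Ordinal.{u}} {a b : Ordinal.{u}} (h : Consecutive Y a b) :
    otp (Y ∩ Iio b) = otp (Y ∩ Iio a) + 1 := by
  obtain ⟨ha, hb, hab, hc⟩ := h
  have h1 : (1 : Ordinal.{u + 1}) = Ordinal.type (emptyRelation : PUnit.{u + 2} → PUnit → Prop) :=
    (Ordinal.type_eq_one_of_unique _).symm
  unfold otp
  rw [h1, ← Ordinal.type_sum_lex, Ordinal.type_eq]
  let f : (Y ∩ Iio a : Set Ordinal.{u}) ⊕ PUnit.{u + 2} → (Y ∩ Iio b : Set Ordinal.{u}) :=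
    Sum.elim (fun x => ⟨x.1, x.2.1, x.2.2.trans hab⟩) fun _ => ⟨a, ha, hab⟩
  refine ⟨(RelIso.ofSurjective (RelEmbedding.ofMonotone f ?_) ?_).symm⟩
  · rintro _ _ (h | h | ⟨x, y⟩)
    · exact h
    · exact h.elim
    · exact x.2.2
  · rintro ⟨x, hx, hxb⟩
    obtain h | h := hc x hx
    · obtain rfl | h := h.eq_or_lt
      · exact ⟨Sum.inr ⟨⟩, rfl⟩
      · exact ⟨Sum.inl ⟨x, hx, h⟩, rfl⟩
    · exact absurd hxb h.not_gt

theorem Consecutive.isNth_add_one {Y : Set Ordinal.{u}} {a b j : Ordinal.{u}}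
    (h : Consecutive Y a b) (ha : IsNth Y j a) : IsNth Y (j + 1) b :=
  ⟨h.2.1, by rw [h.otp_eq, ha.2]; simp⟩

theorem exists_isNth {Y : Set Ordinal.{u}} {a : Ordinal.{u}} (ha : a ∈ Y) :
    ∃ j, IsNth Y j a :=
  let ⟨j, hj⟩ := Ordinal.mem_range_lift_of_le (otp_inter_Iio_le Y a)
  ⟨j, ha, hj.symm⟩

theorem isNth_zero_of_inter_Iio_eq_empty {Y : Set Ordinal.{u}} {a : Ordinal.{u}} (ha : a ∈ Y)
    (h : Y ∩ Iio a = ∅) : IsNth Y 0 a := by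
  refine ⟨ha, ?_⟩
  rw [h, Ordinal.lift_zero]
  exact Ordinal.type_eq_zero_of_empty _

theorem Consecutive.of_inter_Ici {x : Set Ordinal.{u}} {a b q : Ordinal.{u}}
    (h : Consecutive (x \ Iio q) a b) : Consecutive x a b :=
  ⟨h.1.1, h.2.1.1, h.2.2.1, fun c hc => (lt_or_ge c q).elim
    (fun hcq => Or.inl (hcq.le.trans (not_lt.1 h.1.2))) fun hcq => h.2.2.2 c ⟨hc, hcq.not_gt⟩⟩

theorem exists_consecutive {x : Set Ordinal.{u}} {a : Ordinal.{u}} (ha : a ∈ x)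
    (h : ∃ c ∈ x, a < c) : ∃ b, Consecutive x a b := by
  have hne : (x ∩ Ioi a).Nonempty := let ⟨c, hc, hac⟩ := h; ⟨c, hc, hac⟩
  have hm := csInf_mem hne
  exact ⟨_, ha, hm.1, hm.2, fun c hc => (le_or_gt c a).imp_right fun hac =>
    csInf_le' ⟨hc, hac⟩⟩

/-- In a set cofinal in `δ`, the elements cofinally often followed by `σ ≥ 1` successors in `A`
give consecutive elements, the second of which belongs to `A`. -/
theorem exists_consecutive_of_sSup_eq {δ σ q : Ordinal.{u}} {C A : Set Ordinal.{u}}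
    (hC : C ⊆ Iio δ) (hcof : ∀ q < δ, ∃ c ∈ C, q < c) (hσ : 0 < σ)
    (h : sSup {β ∈ C | suc σ (C \ Iio β) ⊆ A} = δ) (hq : q < δ) :
    ∃ a b, q < a ∧ Consecutive C a b ∧ b ∈ A ∧
      (1 < σ → ∃ c, Consecutive C b c ∧ c ∈ A) := by
  -- The supremum of the empty set is `0`, which is not `δ` because `q < δ`.
  have hne : {β ∈ C | suc σ (C \ Iio β) ⊆ A}.Nonempty := by
    by_contra hne
    rw [not_nonempty_iff_eq_empty.1 hne, csSup_empty] at h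
    exact zero_le.not_gt (h ▸ hq)
  obtain ⟨a, ⟨ha, hs⟩, hqa⟩ := exists_lt_of_lt_csSup hne (h.symm ▸ hq)
  have hcof' : ∀ b ∈ C \ Iio a, ∃ c ∈ C \ Iio a, b < c := fun b hb => by
    obtain ⟨c, hc, hbc⟩ := hcof b (hC hb.1)
    exact ⟨c, ⟨hc, ((not_lt.1 hb.2).trans hbc.le).not_gt⟩, hbc⟩
  have ha' : a ∈ C \ Iio a := ⟨ha, lt_irrefl a⟩
  have h0 : IsNth (C \ Iio a) 0 a :=
    isNth_zero_of_inter_Iio_eq_empty ha' (by ext; simp +contextual)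
  obtain ⟨b, hb⟩ := exists_consecutive ha' (hcof' a ha')
  obtain ⟨c, hc⟩ := exists_consecutive hb.2.1 (hcof' b hb.2.1)
  have h1 := hb.isNth_add_one h0
  have h2 := hc.isNth_add_one h1
  -- `suc` starts at position `1`, so nothing is claimed about `a`. The index `0 < σ` gives `b`, and
  -- the index `1 < σ` gives `c`.
  refine ⟨a, b, hqa, hb.of_inter_Ici, hs ⟨0, hσ, h1⟩, fun hσ' => ⟨c, hc.of_inter_Ici, hs ⟨1, hσ', ?_⟩⟩⟩
  simpa using h2

end OrderType

/-! ### Filling gaps -/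

/-- Insert into each gap of `x` that is bounded above by a limit ordinal `β` the first two elements
of `W β` lying in that gap. -/
def fill (W : Ordinal.{u} → Set Ordinal.{u}) (x : Set Ordinal.{u}) : Set Ordinal.{u} :=
  x ∪ {ζ | ∃ α β, Consecutive x α β ∧ IsSuccLimit β ∧ ζ ∈ W β ∩ Ioo α β ∧
    (W β ∩ Ioo α ζ).Subsingleton}

section Fill

variable {W : Ordinal.{u} → Set Ordinal.{u}} {x : Set Ordinal.{u}}

theorem subset_fill : x ⊆ fill W x :=
  subset_union_left

theorem Consecutive.eq_of_lt {a b a' b' : Ordinal.{u}} (h : Consecutive x a b)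
    (h' : Consecutive x a' b') (h1 : a < b') (h2 : a' < b) : a = a' ∧ b = b' :=
  ⟨le_antisymm ((h'.2.2.2 a h.1).resolve_right h1.not_ge)
    ((h.2.2.2 a' h'.1).resolve_right h2.not_ge),
   le_antisymm ((h.2.2.2 b' h'.2.1).resolve_left h1.not_ge)
    ((h'.2.2.2 b h.2.1).resolve_left h2.not_ge)⟩

theorem Consecutive.mem_of_mem_fill {a b ζ : Ordinal.{u}} (h : Consecutive x a b)
    (hζ : ζ ∈ fill W x) (h1 : a < ζ) (h2 : ζ < b) :
    ζ ∈ W b ∧ (W b ∩ Ioo a ζ).Subsingleton := by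
  obtain hζ | ⟨α, β, h', -, ⟨hW, hl⟩, hs⟩ := hζ
  · exact ((h.2.2.2 ζ hζ).elim h1.not_ge h2.not_ge).elim
  · obtain ⟨rfl, rfl⟩ := h.eq_of_lt h' (h1.trans hl.2) (hl.1.trans h2)
    exact ⟨hW, hs⟩

theorem fill_subset_Iio {δ : Ordinal.{u}} (hx : x ⊆ Iio δ) : fill W x ⊆ Iio δ := by
  rintro ζ (hζ | ⟨α, β, h, -, hζ, -⟩)
  · exact hx hζ
  · exact hζ.2.2.trans (hx h.2.1)

/-- Points of a single gap cannot accumulate: below any inserted point its gap contains at most one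
point of `W β`. -/
theorem LimPt.of_fill {p : Ordinal.{u}} (h : LimPt (fill W x) p) : LimPt x p := by
  refine ⟨h.1, fun q hq => ?_⟩
  by_contra hno
  push Not at hno
  obtain ⟨ζ₀, -, hq0, hζ0p⟩ := h.2 q hq
  obtain ⟨ζ₁, hζ₁, h01, h1p⟩ := h.2 ζ₀ hζ0p
  obtain ⟨ζ₂, hζ₂, h12, h2p⟩ := h.2 ζ₁ h1p
  obtain ⟨ζ₃, hζ₃, h23, h3p⟩ := h.2 ζ₂ h2p
  have hq3 := hq0.trans (h01.trans (h12.trans h23))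
  -- With no point of `x` in `(q, p)`, the gap containing `ζ₃` starts at or below `q`. It then
  -- contains both `ζ₁` and `ζ₂` below `ζ₃`, one too many.
  obtain hζ₃' | ⟨α, β, hc, -, ⟨-, hl⟩, -⟩ := id hζ₃
  · exact (hno ζ₃ hζ₃' hq3).not_gt h3p
  have hαq : α ≤ q := by
    by_contra hlt
    exact (hno α hc.1 (not_le.1 hlt)).not_gt (hl.1.trans h3p)
  have hα1 : α < ζ₁ := hαq.trans_lt (hq0.trans h01)
  obtain ⟨-, hs⟩ := hc.mem_of_mem_fill hζ₃ hl.1 hl.2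
  have h1 := (hc.mem_of_mem_fill hζ₁ hα1 ((h12.trans h23).trans hl.2)).1
  have h2 := (hc.mem_of_mem_fill hζ₂ (hα1.trans h12) (h23.trans hl.2)).1
  exact h12.ne (hs ⟨h1, hα1, h12.trans h23⟩ ⟨h2, hα1.trans h12, h23⟩)

/-- No gap straddles a limit point `p` of `x`, and what is inserted depends only on the gap. -/
theorem fill_inter_Iio {p : Ordinal.{u}} (hp : LimPt x p) :
    fill W (x ∩ Iio p) = fill W x ∩ Iio p := by
  ext ζ
  constructor
  · rintro (hζ | ⟨α, β, h, hβ, hζ, hs⟩)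
    · exact ⟨Or.inl hζ.1, hζ.2⟩
    · refine ⟨Or.inr ⟨α, β, ⟨h.1.1, h.2.1.1, h.2.2.1, fun c hc => ?_⟩, hβ, hζ, hs⟩,
        hζ.2.2.trans h.2.1.2⟩
      obtain hcp | hcp := lt_or_ge c p
      · exact h.2.2.2 c ⟨hc, hcp⟩
      · exact Or.inr (h.2.1.2.le.trans hcp)
  · rintro ⟨hζ | ⟨α, β, h, hβ, hζ, hs⟩, hζp⟩
    · exact Or.inl ⟨hζ, hζp⟩
    · obtain ⟨c, hc, hζc, hcp⟩ := hp.2 ζ hζp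
      have hβp : β < p :=
        ((h.2.2.2 c hc).resolve_left (hζ.2.1.trans hζc).not_ge).trans_lt hcp
      exact Or.inr ⟨α, β, ⟨⟨h.1, h.2.2.1.trans hβp⟩, ⟨h.2.1, hβp⟩, h.2.2.1,
        fun c hc => h.2.2.2 c hc.1⟩, hβ, hζ, hs⟩

/-- This is why `fill` treats only gaps with a limit right endpoint: such an endpoint is in `nacc
x`, so sets exempted from end-extension by `InitSegLower` stay untouched. -/
theorem fill_eq_self (h : ∀ β ∈ nacc x, ∃ γ, β = succ γ) : fill W x = x := by
  refine subset_antisymm ?_ subset_fill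
  rintro ζ (hζ | ⟨α, β, hc, hβ, -, -⟩)
  · exact hζ
  · have : β ∈ nacc x := ⟨hc.2.1, fun hacc => by
      obtain ⟨c, hcx, h1, h2⟩ := (mem_acc_iff.1 hacc).2.2 α hc.2.2.1
      exact (hc.2.2.2 c hcx).elim h1.not_ge h2.not_ge⟩
    obtain ⟨γ, rfl⟩ := h β this
    exact (not_isSuccLimit_succ γ hβ).elim

theorem fill_empty : fill (fun _ => ∅) x = x := by
  refine subset_antisymm ?_ subset_fill
  rintro ζ (hζ | ⟨α, β, hc, hβ, hζ, -⟩)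
  · exact hζ
  · exact hζ.1.elim

/-- A gap below `b` in which `W b` is unbounded receives two consecutive elements of `W b`. -/
theorem Consecutive.exists_consecutive_fill {a b q : Ordinal.{u}} (h : Consecutive x a b)
    (hW : LimPt (W b) b) (hqa : q ≤ a) :
    ∃ ζ η, Consecutive (fill W x ∩ Ioi q) ζ η ∧ ζ ∈ W b ∧ η ∈ W b := by
  have next : ∀ r, a ≤ r → r < b → ∃ ζ ∈ W b, r < ζ ∧ ζ < b ∧ ∀ ξ ∈ W b, r < ξ → ζ ≤ ξ := by
    intro r hr hrb
    have hne : (W b ∩ Ioi r).Nonempty := let ⟨c, hc, h1, _⟩ := hW.2 r hrb; ⟨c, hc, h1⟩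
    obtain ⟨c, hc, h1, h2⟩ := hW.2 r hrb
    exact ⟨_, (csInf_mem hne).1, (csInf_mem hne).2, (csInf_le' (show c ∈ W b ∩ Ioi r from ⟨hc, h1⟩)).trans_lt h2,
      fun ξ hξ hrξ => csInf_le' ⟨hξ, hrξ⟩⟩
  obtain ⟨ζ, hζ, haζ, hζb, hζmin⟩ := next a le_rfl h.2.2.1
  obtain ⟨η, hη, hζη, hηb, hηmin⟩ := next ζ haζ.le hζb
  refine ⟨ζ, η, ⟨⟨Or.inr ⟨a, b, h, hW.isSuccLimit, ⟨hζ, haζ, hζb⟩, ?_⟩, hqa.trans_lt haζ⟩,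
    ⟨Or.inr ⟨a, b, h, hW.isSuccLimit, ⟨hη, haζ.trans hζη, hηb⟩, ?_⟩,
      hqa.trans_lt (haζ.trans hζη)⟩, hζη, fun ξ hξ => ?_⟩, hζ, hη⟩
  · rintro ξ ⟨h1, h2, h3⟩
    exact absurd (hζmin ξ h1 h2) h3.not_ge
  · have key : ∀ ξ ∈ W b ∩ Ioo a η, ξ = ζ := fun ξ hξ =>
      le_antisymm (not_lt.1 fun hlt => (hηmin ξ hξ.1 hlt).not_gt hξ.2.2) (hζmin ξ hξ.1 hξ.2.1)
    exact fun ξ hξ ξ' hξ' => (key ξ hξ).trans (key ξ' hξ').symm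
  · by_contra! hcon
    exact (hηmin ξ (h.mem_of_mem_fill hξ.1 (haζ.trans hcon.1) (hcon.2.trans hηb)).1
      hcon.1).not_gt hcon.2

end Fill

/-! ### Cutting, filling and coherence -/

open Classical in
/-- The `C`-sequence obtained from `C` by filling gaps and then removing the elements `≤ γ`. -/
noncomputable def cutFill (W : Ordinal.{u} → Set Ordinal.{u}) (γ : Ordinal.{u})
    (C : Ordinal.{u} → Set Ordinal.{u}) (δ : Ordinal.{u}) : Set Ordinal.{u} :=
  if IsSuccLimit δ then if δ ≤ γ then C δ else fill W (C δ) ∩ Ioi γ else ∅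

section CutFill

variable {W : Ordinal.{u} → Set Ordinal.{u}} {γ δ κ : Ordinal.{u}} {C : Ordinal.{u} → Set Ordinal.{u}}

theorem cutFill_of_le (hδ : IsSuccLimit δ) (h : δ ≤ γ) : cutFill W γ C δ = C δ := by
  simp [cutFill, hδ, h]

theorem cutFill_of_lt (hδ : IsSuccLimit δ) (h : γ < δ) :
    cutFill W γ C δ = fill W (C δ) ∩ Ioi γ := by
  simp [cutFill, hδ, h]

theorem isClubIn_cutFill (hδ : IsSuccLimit δ) (hC : IsClubIn δ (C δ)) :
    IsClubIn δ (cutFill W γ C δ) := by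
  obtain h | h := le_or_gt δ γ
  · rwa [cutFill_of_le hδ h]
  rw [cutFill_of_lt hδ h]
  obtain ⟨h1, h2, h3⟩ := (isClubIn_iff hδ).1 hC
  refine (isClubIn_iff hδ).2 ⟨inter_subset_left.trans (fill_subset_Iio h1), fun q hq => ?_,
    fun p hp hlim => ⟨subset_fill (h3 p hp (hlim.mono inter_subset_left).of_fill), ?_⟩⟩
  · obtain ⟨c, hc, hlt⟩ := h2 _ (max_lt h hq)
    exact ⟨c, ⟨subset_fill hc, (le_max_left _ _).trans_lt hlt⟩, (le_max_right _ _).trans_lt hlt⟩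
  · obtain ⟨c, hc, -, hcp⟩ := hlim.2 0 hlim.1
    exact hc.2.trans hcp

theorem isCSequence_cutFill (hC : ∀ α < κ, IsSuccLimit α → IsClubIn α (C α)) :
    IsCSequence (Iio κ) (cutFill W γ C) :=
  fun α hα hlim => isClubIn_cutFill hlim (hC α hα hlim)

theorem sSup_eq_of_isClubIn {D : Set Ordinal.{u}} (hδ : IsSuccLimit δ) (hD : IsClubIn δ D) :
    sSup D = δ := by
  obtain ⟨h1, h2, -⟩ := (isClubIn_iff hδ).1 hD
  refine le_antisymm (csSup_le' fun c hc => (h1 hc).le) ?_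
  by_contra! hlt
  obtain ⟨c, hc, hlt⟩ := h2 _ hlt
  exact hlt.not_ge (le_csSup ⟨δ, fun c hc => (h1 hc).le⟩ hc)

/-- As `D` is unbounded in `β` and omits `β ∈ x`, the cutting point can only be `β`. -/
theorem initSeg_iff_of_isClubIn {β : Ordinal.{u}} {D x : Set Ordinal.{u}} (hβ : IsSuccLimit β)
    (hD : IsClubIn β D) (hβx : β ∈ x) : InitSeg D x ↔ D = x ∩ Iio β := by
  refine ⟨fun ⟨b, hb⟩ => ?_, fun h => ⟨β, h⟩⟩
  obtain ⟨h1, h2, -⟩ := (isClubIn_iff hβ).1 hD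
  obtain hlt | rfl | hlt := lt_trichotomy b β
  · obtain ⟨c, hc, hbc⟩ := h2 b hlt
    rw [hb] at hc
    exact absurd hc.2 hbc.not_gt
  · exact hb
  · exact absurd (h1 (hb ▸ ⟨hβx, hlt⟩ : β ∈ D)) (lt_irrefl β)

/-- If `R` is preserved by `cutFill` at accumulation points past the cut, then so is coherence. -/
theorem isCoherent_cutFill {R : Set Ordinal.{u} → Set Ordinal.{u} → Prop}
    (hC : ∀ α < κ, IsSuccLimit α → IsClubIn α (C α))
    (hR : ∀ α < κ, IsSuccLimit α → ∀ β ∈ acc (C α), R (C β) (C α))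
    (hstep : ∀ α β, IsClubIn β (C β) → IsSuccLimit β → γ < β → β ∈ C α → LimPt (C α) β →
      R (C β) (C α) → R (fill W (C β) ∩ Ioi γ) (fill W (C α) ∩ Ioi γ)) :
    IsCoherent R (Iio κ) (cutFill W γ C) := by
  intro α hα β hβ
  by_cases hlim : IsSuccLimit α
  swap
  -- The value at non-limit ordinals is `∅` because `hR` says nothing there.
  · rw [cutFill, if_neg hlim] at hβ
    exact hβ.1.elim
  have hclub := hC α hα hlim
  have hβα : β < α := (isClubIn_cutFill hlim hclub).1 hβ.1
  have hβlim := (mem_acc_iff.1 hβ).2.isSuccLimit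
  refine ⟨hβα.trans hα, ?_⟩
  obtain h | h := le_or_gt α γ
  · rw [cutFill_of_le hlim h] at hβ ⊢
    rw [cutFill_of_le hβlim (hβα.le.trans h)]
    exact hR α hα hlim β hβ
  · rw [cutFill_of_lt hlim h] at hβ ⊢
    have hγβ : γ < β := hβ.1.2
    -- Accumulation points of the new set are old ones above `γ`, so both sets are cut at the same
    -- place.
    have hL : LimPt (C α) β := ((mem_acc_iff.1 hβ).2.mono inter_subset_left).of_fill
    have hβC : β ∈ C α := ((isClubIn_iff hlim).1 hclub).2.2 β hβα hL
    rw [cutFill_of_lt hβlim hγβ]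
    exact hstep α β (hC β (hβα.trans hα) hβlim) hβlim hγβ hβC hL
      (hR α hα hlim β (mem_acc_iff.2 ⟨hβC, hL⟩))

theorem initSeg_fill_inter_Ioi {β : Ordinal.{u}} {D x : Set Ordinal.{u}} (hD : IsClubIn β D)
    (hβ : IsSuccLimit β) (hβx : β ∈ x) (hL : LimPt x β) (h : InitSeg D x) :
    InitSeg (fill W D ∩ Ioi γ) (fill W x ∩ Ioi γ) := by
  rw [initSeg_iff_of_isClubIn hβ hD hβx] at h
  exact ⟨β, by rw [h, fill_inter_Iio hL, inter_right_comm]⟩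

/-- The exceptional clause concerns only the supremum, which remains `β` after filling and cutting.
-/
theorem isCoherent_cutFill_initSegUpper {χ : Cardinal.{u}}
    (hC : ∀ α < κ, IsSuccLimit α → IsClubIn α (C α))
    (hR : ∀ α < κ, IsSuccLimit α → ∀ β ∈ acc (C α), InitSegUpper χ (C β) (C α)) :
    IsCoherent (InitSegUpper χ) (Iio κ) (cutFill W γ C) := by
  refine isCoherent_cutFill hC hR fun α β hclub hβ hγβ hβC hL h => ?_
  refine h.imp (initSeg_fill_inter_Ioi hclub hβ hβC hL) fun hcof => ?_
  rw [sSup_eq_of_isClubIn hβ hclub] at hcof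
  have := isClubIn_cutFill (W := W) (γ := γ) hβ hclub
  rw [cutFill_of_lt hβ hγβ] at this
  rwa [sSup_eq_of_isClubIn hβ this]

/-- In the exceptional clause nothing is filled, and cutting creates no new non-accumulation points
because accumulation points above `γ` stay so. -/
theorem isCoherent_cutFill_initSegLower {χ : Cardinal.{u}}
    (hC : ∀ α < κ, IsSuccLimit α → IsClubIn α (C α))
    (hR : ∀ α < κ, IsSuccLimit α → ∀ β ∈ acc (C α), InitSegLower χ (C β) (C α)) :
    IsCoherent (InitSegLower χ) (Iio κ) (cutFill W γ C) := by
  refine isCoherent_cutFill hC hR fun α β hclub hβ hγβ hβC hL h => ?_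
  refine h.imp (initSeg_fill_inter_Ioi hclub hβ hβC hL) fun ⟨hotp, hsucc⟩ => ?_
  rw [fill_eq_self hsucc]
  refine ⟨(otp_mono inter_subset_left).trans_lt hotp, fun ξ hξ => ?_⟩
  by_cases hξα : ξ ∈ acc (C α)
  · obtain ⟨h0, hlim⟩ := (mem_acc_iff.1 hξα).2
    refine (hξ.2 (mem_acc_iff.2 ⟨hξ.1, h0, fun q hq => ?_⟩)).elim
    obtain ⟨c, hc, h1, h2⟩ := hlim _ (max_lt (show γ < ξ from hξ.1.2) hq)
    exact ⟨c, ⟨hc, (le_max_left _ _).trans_lt h1⟩, (le_max_right _ _).trans_lt h1, h2⟩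
  · exact hsucc ξ ⟨hξ.1.1, hξα⟩

end CutFill

/-! ### Choosing the variant that captures -/

section Capturing

variable {κ θ : Cardinal.{u}}

/-- A family of `κ` many `C`-sequences contains one that captures stationarily, provided that
candidates for counterexamples can be refuted simultaneously. -/
theorem exists_capturesStationarily {F : Ordinal.{u} → Ordinal.{u} → Set Ordinal.{u}}
    (h : ∀ (A : Ordinal.{u} → Ordinal.{u} → Set Ordinal.{u}) (D : Ordinal.{u} → Set Ordinal.{u}),
      (∀ γ < κ.ord, ∀ i < θ.ord, IsCofinalIn κ.ord (A γ i)) →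
      (∀ γ < κ.ord, IsClubIn κ.ord (D γ)) →
      ∃ δ < κ.ord, (∀ γ < δ, δ ∈ D γ) ∧ ∃ γ < δ, Captures (F γ) θ.ord (A γ) δ) :
    ∃ γ, CapturesStationarily κ θ (F γ) := by
  by_contra! hno
  simp only [CapturesStationarily, not_forall] at hno
  choose A hA hns using hno
  choose D hD hdis using fun γ => exists_isClubIn_of_not_isStationaryIn (fun x hx => hx.1) (hns γ)
  obtain ⟨δ, hδ, hδD, γ, hγ, hcap⟩ := h A D (fun γ _ => hA γ) fun γ _ => hD γ
  exact hdis γ δ (hδD γ hγ) ⟨hδ, hcap⟩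

theorem Consecutive.exists_isNth {Y A : Set Ordinal.{u}} {a b : Ordinal.{u}}
    (h : Consecutive Y a b) (ha : a ∈ A) (hb : b ∈ A) :
    ∃ ι x y, IsNth Y ι x ∧ IsNth Y (ι + 1) y ∧ x ∈ A ∧ y ∈ A :=
  let ⟨j, hj⟩ := ProxyCapture.exists_isNth h.1
  ⟨j, a, b, hj, h.isNth_add_one hj, ha, hb⟩

/-- Cutting alone suffices here, since `σ = 2` already puts consecutive pairs of `C δ` into each
set. -/
theorem exists_capturesStationarily_of_two (hκ : κ.IsRegular) (hκ₀ : ℵ₀ < κ)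
    {C : Ordinal.{u} → Set Ordinal.{u}} {S : Set Ordinal.{u}}
    (hC : ∀ α < κ.ord, IsSuccLimit α → IsClubIn α (C α))
    (hhit : ∀ A : Ordinal.{u} → Set Ordinal.{u}, (∀ i < κ.ord, IsCofinalIn κ.ord (A i)) →
      IsStationaryIn κ.ord {α ∈ S | ∀ i < min α κ.ord,
        sSup {β ∈ C α | suc 2 (C α \ Iio β) ⊆ A i} = α}) :
    ∃ γ, CapturesStationarily κ κ (cutFill (fun _ => ∅) γ C) := by
  refine exists_capturesStationarily fun A D hA hD => ?_
  obtain ⟨p, hpκ, hpinj⟩ := exists_injective_pairing hκ.aleph0_le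
  have h0 : 0 < κ.ord := hκ.ord_pos
  have hm : ∀ γ < κ.ord, sInf (A γ 0) < κ.ord := fun γ hγ => by
    obtain ⟨c, hc, -⟩ := (hA γ hγ 0 h0).exists_lt hκ.aleph0_le h0
    exact (csInf_le' hc).trans_lt ((hA γ hγ 0 h0).1 hc)
  have hE := isClubIn_diagonal hκ hκ₀ fun γ hγ => isClubIn_Ioo hκ (hm γ hγ)
  set E := diagonal κ fun γ => Ioo (sInf (A γ 0)) κ.ord
  -- The slot `0` is sacrificed to hit `E`, whose members `ε` exceed `min (A γ 0)` for all `γ < ε`.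
  -- This costs nothing, as the cut will be made at some `α > 0`.
  let A' : Ordinal.{u} → Ordinal.{u} → Set Ordinal.{u} := Function.update A 0 fun _ => E
  have hA' : ∀ γ < κ.ord, ∀ i < κ.ord, IsCofinalIn κ.ord (A' γ i) := fun γ hγ i hi => by
    obtain rfl | hne := eq_or_ne γ 0
    · simpa [A'] using hE.isCofinalIn
    · simpa [A', hne] using hA γ hγ i hi
  -- At a code `p γ i` this is `A' γ i`. At any other index the condition is vacuous and the set is
  -- all of `κ`.
  let B : Ordinal.{u} → Set Ordinal.{u} := fun k =>
    {x | x < κ.ord ∧ ∀ γ < κ.ord, ∀ i < κ.ord, k = p γ i → x ∈ A' γ i}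
  have hBp : ∀ γ < κ.ord, ∀ i < κ.ord, B (p γ i) = A' γ i := fun γ hγ i hi => by
    ext x
    refine ⟨fun hx => hx.2 γ hγ i hi rfl, fun hx => ⟨(hA' γ hγ i hi).1 hx,
      fun γ' hγ' i' hi' heq => ?_⟩⟩
    obtain ⟨rfl, rfl⟩ := hpinj γ hγ i hi γ' hγ' i' hi' heq
    exact hx
  have hB : ∀ k < κ.ord, IsCofinalIn κ.ord (B k) := fun k _ => by
    by_cases hk : ∃ γ < κ.ord, ∃ i < κ.ord, k = p γ i
    · obtain ⟨γ, hγ, i, hi, rfl⟩ := hk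
      rw [hBp γ hγ i hi]
      exact hA' γ hγ i hi
    · refine isCofinalIn_of_forall_exists_lt (fun x hx => hx.1) fun q hq => ?_
      have := (isSuccLimit_ord hκ.aleph0_le).succ_lt hq
      exact ⟨succ q, ⟨this, fun γ hγ i hi heq => (hk ⟨γ, hγ, i, hi, heq⟩).elim⟩, lt_succ q⟩
  obtain ⟨δ, ⟨-, hδ⟩, ⟨hδκ, hlim, hδD⟩, -, -, hδp⟩ := (hhit B hB).exists_mem
    ((isClubIn_diagonal hκ hκ₀ hD).inter hκ hκ₀ (isClubIn_closurePoints hκ hκ₀ hpκ))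
  obtain ⟨hCδ, hcof, -⟩ := (isClubIn_iff hlim).1 (hC δ hδκ hlim)
  have hpair : ∀ γ < δ, ∀ i < δ, ∀ q < δ, ∃ a b c, q < a ∧ Consecutive (C δ) a b ∧
      Consecutive (C δ) b c ∧ b ∈ A' γ i ∧ c ∈ A' γ i := fun γ hγ i hi q hq => by
    have hlt : p γ i < δ := hδp γ hγ i hi
    obtain ⟨a, b, hqa, hab, hb, hc⟩ := exists_consecutive_of_sSup_eq hCδ hcof zero_lt_two
      (hδ (p γ i) (lt_min hlt (hlt.trans hδκ))) hq
    obtain ⟨c, hbc, hc⟩ := hc one_lt_two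
    rw [hBp γ (hγ.trans hδκ) i (hi.trans hδκ)] at hb hc
    exact ⟨a, b, c, hqa, hab, hbc, hb, hc⟩
  have h0δ : 0 < δ := hlim.bot_lt
  -- `ε ∈ E` follows `α` in `C δ`, so after the cut at `α` it is the minimum, and it exceeds `min (A
  -- α 0)`.
  obtain ⟨α, ε, -, hα0, hαε, -, hεE, -⟩ := hpair 0 h0δ 0 h0δ 0 h0δ
  have hεE : ε ∈ E := by simpa [A'] using hεE
  have hαδ : α < δ := hCδ hαε.1
  refine ⟨δ, hδκ, hδD, α, hαδ, ?_⟩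
  have hF : cutFill (fun _ => ∅) α C δ = C δ ∩ Ioi α := by
    rw [cutFill_of_lt hlim hαδ, fill_empty]
  have hne : (C δ ∩ Ioi α).Nonempty := ⟨ε, hαε.2.1, hαε.2.2.1⟩
  refine ⟨?_, fun i hi => ?_⟩
  · rw [hF]
    refine ⟨hne, le_csInf hne fun ζ hζ => ?_⟩
    exact ((hεE.2.2 α hαε.2.2.1).1.le).trans
      ((hαε.2.2.2 ζ hζ.1).resolve_left (show α < ζ from hζ.2).not_ge)
  · obtain ⟨a, b, c, hqa, hab, hbc, hb, hc⟩ := hpair α hαδ i (lt_min_iff.1 hi).1 α hαδ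
    have hA'α : A' α = A α := Function.update_of_ne hα0.ne' _ _
    rw [hA'α] at hb hc
    have hαb := hqa.trans hab.2.2.1
    rw [hF]
    exact Consecutive.exists_isNth ⟨⟨hbc.1, hαb⟩, ⟨hbc.2.1, hαb.trans hbc.2.2.1⟩, hbc.2.2.1,
      fun d hd => hbc.2.2.2 d hd.1⟩ hb hc

/-- Diamond guesses `κ`-sequences of cofinal subsets of `κ`. -/
theorem Diamond.exists_guess (hκ : κ.IsRegular) (hκ₀ : ℵ₀ < κ) (h : Diamond κ) :
    ∃ W : Ordinal.{u} → Ordinal.{u} → Set Ordinal.{u}, ∀ A : Ordinal.{u} → Set Ordinal.{u},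
      (∀ γ < κ.ord, IsCofinalIn κ.ord (A γ)) → IsCofinalIn κ.ord
        {β | β < κ.ord ∧ ∀ γ < β, W γ β = A γ ∩ Iio β ∧ LimPt (W γ β) β} := by
  obtain ⟨Z, -, hZ⟩ := h
  obtain ⟨p, hpκ, hpinj⟩ := exists_injective_pairing hκ.aleph0_le
  refine ⟨fun γ β => {ξ | ξ < β ∧ p γ ξ ∈ Z β}, fun A hA => ?_⟩
  -- Diamond guesses this set of codes. Closure of `β` under `p` and injectivity allow each `A γ ∩
  -- β` to be decoded from its trace on `β`.
  have hX : {x | ∃ γ < κ.ord, ∃ ξ ∈ A γ, p γ ξ = x} ⊆ Iio κ.ord := by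
    rintro _ ⟨γ, hγ, ξ, hξ, rfl⟩
    exact hpκ γ hγ ξ ((hA γ hγ).1 hξ)
  have hcof := (hZ _ hX).isCofinalIn_inter hκ hκ₀ ((isClubIn_closurePoints hκ hκ₀ hpκ).inter hκ hκ₀
    (isClubIn_diagonal hκ hκ₀ fun γ hγ => isClubIn_limPt hκ hκ₀ (hA γ hγ)))
  refine isCofinalIn_of_forall_exists_lt (fun β hβ => hβ.1) fun q hq => ?_
  obtain ⟨β, ⟨⟨hβκ, hXZ⟩, ⟨-, -, hβp⟩, -, -, hβA⟩, hqβ⟩ := hcof.exists_lt hκ.aleph0_le hq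
  refine ⟨β, ⟨hβκ, fun γ hγ => ?_⟩, hqβ⟩
  have heq : {ξ | ξ < β ∧ p γ ξ ∈ Z β} = A γ ∩ Iio β := by
    rw [← hXZ]
    ext ξ
    refine ⟨fun ⟨hξβ, hξ⟩ => ⟨?_, hξβ⟩, fun ⟨hξ, hξβ⟩ =>
      ⟨hξβ, ⟨γ, hγ.trans hβκ, ξ, hξ, rfl⟩, hβp γ hγ ξ hξβ⟩⟩
    obtain ⟨γ', hγ', ξ', hξ', he⟩ := hξ.1
    obtain ⟨rfl, rfl⟩ := hpinj γ' hγ' ξ' ((hA γ' hγ').1 hξ') γ (hγ.trans hβκ) ξ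
      (hξβ.trans hβκ) he
    exact hξ'
  beta_reduce
  rw [heq]
  obtain ⟨-, h0, hlim⟩ := hβA γ hγ
  refine ⟨rfl, h0, fun q hq => ?_⟩
  obtain ⟨c, hc, h1, h2⟩ := hlim q hq
  exact ⟨c, ⟨hc, h2⟩, h1, h2⟩

/-- The index `i` need not be known when filling: `W γ` guesses one set at each `β`, and hitting `β
∈ G i` reveals that the guess there was `A γ i`. -/
theorem exists_capturesStationarily_of_diamond (hκ : κ.IsRegular) (hκ₀ : ℵ₀ < κ) (hθ : θ ≠ 0)
    {C : Ordinal.{u} → Set Ordinal.{u}} {S : Set Ordinal.{u}}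
    (hC : ∀ α < κ.ord, IsSuccLimit α → IsClubIn α (C α))
    (hhit : ∀ A : Ordinal.{u} → Set Ordinal.{u}, (∀ i < θ.ord, IsCofinalIn κ.ord (A i)) →
      IsStationaryIn κ.ord {α ∈ S | ∀ i < min α θ.ord,
        sSup {β ∈ C α | suc 1 (C α \ Iio β) ⊆ A i} = α})
    (hdiamond : Diamond κ) :
    ∃ W γ, CapturesStationarily κ θ (cutFill W γ C) := by
  obtain ⟨W, hWguess⟩ := hdiamond.exists_guess hκ hκ₀
  suffices ∃ γ, CapturesStationarily κ θ (cutFill (W γ) γ C) from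
    let ⟨γ, hγ⟩ := this
    ⟨W γ, γ, hγ⟩
  refine exists_capturesStationarily fun A D hA hD => ?_
  obtain ⟨G, hG, hW⟩ : ∃ G : Ordinal.{u} → Set Ordinal.{u},
      (∀ i < θ.ord, IsCofinalIn κ.ord (G i)) ∧
      ∀ i, ∀ β ∈ G i, ∀ γ < β, W γ β = A γ i ∩ Iio β ∧ LimPt (W γ β) β :=
    ⟨_, fun i hi => hWguess (fun γ => A γ i) fun γ hγ => hA γ hγ i hi, fun i β hβ => hβ.2⟩
  obtain ⟨δ, ⟨-, hδ⟩, hδκ, hlim, hδD⟩ := (hhit G hG).exists_mem (isClubIn_diagonal hκ hκ₀ hD)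
  obtain ⟨hCδ, hcof, -⟩ := (isClubIn_iff hlim).1 (hC δ hδκ hlim)
  have hgap : ∀ i < min δ θ.ord, ∀ q < δ, ∃ a b, q < a ∧ Consecutive (C δ) a b ∧ b ∈ G i :=
    fun i hi q hq => by
      obtain ⟨a, b, hqa, hab, hb, -⟩ := exists_consecutive_of_sSup_eq hCδ hcof zero_lt_one
        (hδ i hi) hq
      exact ⟨a, b, hqa, hab, hb⟩
  have h0δ : 0 < δ := hlim.bot_lt
  have h0θ : 0 < θ.ord := by simpa [pos_iff_ne_zero] using hθ
  obtain ⟨α, ε, -, hαε, hε⟩ := hgap 0 (lt_min h0δ h0θ) 0 h0δ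
  have hαδ : α < δ := hCδ hαε.1
  refine ⟨δ, hδκ, hδD, α, hαδ, ?_⟩
  have hF : cutFill (W α) α C δ = fill (W α) (C δ) ∩ Ioi α := cutFill_of_lt hlim hαδ
  have hne : (fill (W α) (C δ) ∩ Ioi α).Nonempty := ⟨ε, subset_fill hαε.2.1, hαε.2.2.1⟩
  refine ⟨?_, fun i hi => ?_⟩
  · rw [hF]
    refine ⟨hne, le_csInf hne fun ζ ⟨hζ, hαζ⟩ => ?_⟩
    obtain ⟨heq, hL⟩ := hW 0 ε hε α hαε.2.2.1
    -- A point inserted in the gap `(α, ε)` lies in `A α 0`. Any other point is at least `ε`, below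
    -- which `A α 0` already has elements.
    obtain hlt | hle := lt_or_ge ζ ε
    · have := (hαε.mem_of_mem_fill hζ hαζ hlt).1
      rw [heq] at this
      exact csInf_le' this.1
    · obtain ⟨c, hc, -, hcε⟩ := hL.2 0 hL.1
      rw [heq] at hc
      exact (csInf_le' hc.1).trans (hcε.le.trans hle)
  · obtain ⟨a, b, hqa, hab, hb⟩ := hgap i hi α hαδ
    obtain ⟨heq, hL⟩ := hW i b hb α (hqa.trans hab.2.2.1)
    obtain ⟨ζ, η, hcons, hζ, hη⟩ := hab.exists_consecutive_fill hL hqa.le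
    rw [heq] at hζ hη
    rw [hF]
    exact hcons.exists_isNth hζ.1 hη.1

end Capturing

end ProxyCapture

theorem mainTheorem11 (χ κ θ : Cardinal.{u}) (hχ : χ.IsRegular) (hκ : κ.IsRegular)
    (hχκ : χ < κ) (hθ : θ ≠ 0) (hθκ : θ < κ) :
    (ProxyMinus κ (InitSegUpper χ) κ {cofGE κ χ} 2 →
      ∃ C : Ordinal.{u} → Set Ordinal.{u}, IsCSequence (Set.Iio κ.ord) C ∧
        IsCoherent (InitSegUpper χ) (Set.Iio κ.ord) C ∧ CapturesStationarily κ κ C) ∧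
    (ProxyMinus κ (InitSegLower χ) κ {Set.Iio κ.ord} 2 →
      ∃ C : Ordinal.{u} → Set Ordinal.{u}, IsCSequence (Set.Iio κ.ord) C ∧
        IsCoherent (InitSegLower χ) (Set.Iio κ.ord) C ∧ CapturesStationarily κ κ C) ∧
    (Proxy κ (InitSegUpper χ) θ {cofGE κ χ} 1 →
      ∃ C : Ordinal.{u} → Set Ordinal.{u}, IsCSequence (Set.Iio κ.ord) C ∧
        IsCoherent (InitSegUpper χ) (Set.Iio κ.ord) C ∧ CapturesStationarily κ θ C) ∧
    (Proxy κ (InitSegLower χ) θ {Set.Iio κ.ord} 1 →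
      ∃ C : Ordinal.{u} → Set Ordinal.{u}, IsCSequence (Set.Iio κ.ord) C ∧
        IsCoherent (InitSegLower χ) (Set.Iio κ.ord) C ∧ CapturesStationarily κ θ C) := by
  have hκ₀ : Cardinal.aleph0 < κ := hχ.aleph0_le.trans_lt hχκ
  refine ⟨?_, ?_, ?_, ?_⟩
  · rintro ⟨C, hC, hR, hhit⟩
    obtain ⟨γ, hγ⟩ := exists_capturesStationarily_of_two hκ hκ₀ hC
      fun A hA => hhit A hA _ rfl
    exact ⟨_, isCSequence_cutFill hC, isCoherent_cutFill_initSegUpper hC hR, hγ⟩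
  · rintro ⟨C, hC, hR, hhit⟩
    obtain ⟨γ, hγ⟩ := exists_capturesStationarily_of_two hκ hκ₀ hC
      fun A hA => hhit A hA _ rfl
    exact ⟨_, isCSequence_cutFill hC, isCoherent_cutFill_initSegLower hC hR, hγ⟩
  · rintro ⟨⟨C, hC, hR, hhit⟩, hd⟩
    obtain ⟨W, γ, hγ⟩ := exists_capturesStationarily_of_diamond hκ hκ₀ hθ hC
      (fun A hA => hhit A hA _ rfl) hd
    exact ⟨_, isCSequence_cutFill hC, isCoherent_cutFill_initSegUpper hC hR, hγ⟩
  · rintro ⟨⟨C, hC, hR, hhit⟩, hd⟩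
    obtain ⟨W, γ, hγ⟩ := exists_capturesStationarily_of_diamond hκ hκ₀ hθ hC
      (fun A hA => hhit A hA _ rfl) hd
    exact ⟨_, isCSequence_cutFill hC, isCoherent_cutFill_initSegLower hC hR, hγ⟩
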